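/- Let $A$ be a finite alphabet with at least three letters. View a string $B=B_1\cdots B_n\in A^n$ as a structure with universe $\{1,\dots,n\}$, the linear order $<$, and a unary predicate $R_a$ for the set of positions carrying the letter $a$, for each $a\in A$. For a formula $\varphi(x;\bar y)$ with one instance variable $x$ and parameter variables $\bar y$ (a \emph{unary} formula), and for a tuple $\bar v$ of positions, let $[\![\varphi(x;\bar v)]\!]^B$ be the set of positions $u$ with $B\models\varphi(u;\bar v)$. A training set over $B$ is a finite set $T\subseteq\{1,\dots,n\}\times\{0,1\}$; a set $H$ of positions is consistent with $T$ if for all $(u,\lambda)\in T$ we have $u\in H\iff\lambda=1$; and $T$ is $\varphi$-consistent over $B$ if $[\![\varphi(x;\bar v)]\!]^B$ is consistent with $T$ for some tuple $\bar v$ of positions of $B$. A $(q,\ell)$-formula learner is a deterministic algorithm that, given the length $n$ of $B$, a training set $T$ and local access to $B$, outputs a hypothesis $H_T=[\![\varphi'(x;\bar v')]\!]^B$ by outputting a monadic second-order formula $\varphi'(x;y_1,\dots,y_\ell)$ of quantifier rank at most $q$ (in particular, possibly a first-order formula) and a tuple $\bar v'$ of $\ell$ positions. Local access means that the algorithm initially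 holds only the positions occurring in $T$, and that in one step it can read the letter at a position it holds, or at the successor or the predecessor of such a position, which it then holds as well. No restriction is put on its internal memory and computations. The learner is sublinear for $\varphi$ if there is a function $f$ with $f(t,n)=o(n)$ as $n\to\infty$ for each fixed $t$, such that it halts after at most $f(|T|,n)$ steps on every string of length $n$ and every $\varphi$-consistent training set $T$ over it. It is consistent for $\varphi$ if on every string and every $\varphi$-consistent training set $T$ it halts with a hypothesis consistent with $T$. \textbf{Theorem.} There is a first-order formula $\varphi(x;y)=\exists z\,\forall z'\,\psi(z,z',x,y)$ over strings over $A$, with quantifier-free $\psi$ and a single parameter variable $y$, such that for all $q,\ell\ge 0$ and every $(q,\ell)$-formula learner $\mathcal L$ that is sublinear for $\varphi$ there are a string $B$ over $A$ and a $\varphi$-consistent training set $T$ over $B$ of size $|T|=2\ell+3$ such that the hypothesis $H_T$ produced by $\mathcal L$ on input $B$ and $T$ is not consistent with $T$. Consequently, there is no consistent formula learner (for any $q,\ell$) for this unary first-order formula $\varphi$ whose running time is sublinear in the length of the string. -/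

import Mathlib

open Filter Asymptotics

/-! ## Monadic second-order logic over strings -/

/-- A string of length `n` over the alphabet `A`; its positions are the elements of `Fin n`. -/
abbrev Str (A : Type) (n : ℕ) : Type := Fin n → A

/-- `MSO A k m`: formulas of monadic second-order logic over the signature `<, (R_a)_{a ∈ A}`
(with equality), with free position variables indexed by `Fin k` and free set variables indexed by
`Fin m`.  A quantifier binds the variable with index `0` of its body; the other variables are
shifted by one.  First-order formulas are those built without the set quantifiers and set
variables. -/
inductive MSO (A : Type) : ℕ → ℕ → Type
  | bot {k m : ℕ} : MSO A k m
  | eq {k m : ℕ} (i j : Fin k) : MSO A k m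
  | lt {k m : ℕ} (i j : Fin k) : MSO A k m
  | letter {k m : ℕ} (a : A) (i : Fin k) : MSO A k m
  | mem {k m : ℕ} (i : Fin k) (X : Fin m) : MSO A k m
  | not {k m : ℕ} (φ : MSO A k m) : MSO A k m
  | and {k m : ℕ} (φ ψ : MSO A k m) : MSO A k m
  | or {k m : ℕ} (φ ψ : MSO A k m) : MSO A k m
  | ex {k m : ℕ} (φ : MSO A (k + 1) m) : MSO A k m
  | all {k m : ℕ} (φ : MSO A (k + 1) m) : MSO A k m
  | exSet {k m : ℕ} (φ : MSO A k (m + 1)) : MSO A k m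
  | allSet {k m : ℕ} (φ : MSO A k (m + 1)) : MSO A k m

namespace MSO

variable {A : Type}

/-- Satisfaction of a formula in the string `w`, under the assignment `v` of positions to position
variables and `V` of sets of positions to set variables. -/
def Holds {n : ℕ} (w : Str A n) :
    {k m : ℕ} → MSO A k m → (Fin k → Fin n) → (Fin m → Set (Fin n)) → Prop
  | _, _, bot, _, _ => False
  | _, _, eq i j, v, _ => v i = v j
  | _, _, lt i j, v, _ => v i < v j
  | _, _, letter a i, v, _ => w (v i) = a
  | _, _, mem i X, v, V => v i ∈ V X
  | _, _, not φ, v, V => ¬ Holds w φ v V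
  | _, _, and φ ψ, v, V => Holds w φ v V ∧ Holds w ψ v V
  | _, _, or φ ψ, v, V => Holds w φ v V ∨ Holds w ψ v V
  | k, _, ex φ, v, V => ∃ p : Fin n, Holds w φ (Fin.cons p v : Fin (k + 1) → Fin n) V
  | k, _, all φ, v, V => ∀ p : Fin n, Holds w φ (Fin.cons p v : Fin (k + 1) → Fin n) V
  | _, m, exSet φ, v, V =>
      ∃ P : Set (Fin n), Holds w φ v (Fin.cons P V : Fin (m + 1) → Set (Fin n))
  | _, m, allSet φ, v, V =>
      ∀ P : Set (Fin n), Holds w φ v (Fin.cons P V : Fin (m + 1) → Set (Fin n))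

/-- Quantifier rank: the maximal number of nested quantifiers. -/
def rank : {k m : ℕ} → MSO A k m → ℕ
  | _, _, bot => 0
  | _, _, eq _ _ => 0
  | _, _, lt _ _ => 0
  | _, _, letter _ _ => 0
  | _, _, mem _ _ => 0
  | _, _, not φ => rank φ
  | _, _, and φ ψ => max (rank φ) (rank ψ)
  | _, _, or φ ψ => max (rank φ) (rank ψ)
  | _, _, ex φ => rank φ + 1
  | _, _, all φ => rank φ + 1
  | _, _, exSet φ => rank φ + 1
  | _, _, allSet φ => rank φ + 1

/-- A formula is quantifier-free if no quantifier occurs in it. -/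
def QuantifierFree {k m : ℕ} (φ : MSO A k m) : Prop := φ.rank = 0

/-- The hypothesis `⟦φ(x ; v)⟧` over the string `w` defined by a unary formula
`φ(x ; y₁, …, y_ℓ)` and the parameter tuple `v`, as the set of selected positions.  Variable `0` is
the instance variable, the variables `1, …, ℓ` are the parameter variables. -/
def concept {ℓ n : ℕ} (φ : MSO A (ℓ + 1) 0) (w : Str A n) (v : Fin ℓ → Fin n) : Set (Fin n) :=
  {u | φ.Holds w (Fin.cons u v : Fin (ℓ + 1) → Fin n) Fin.elim0}

end MSO

/-! ## Training sets and consistency -/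

/-- A training set over strings of length `n`: a finite set of labelled positions. -/
abbrev TrainingSet (n : ℕ) : Type := Finset (Fin n × Bool)

/-- The hypothesis `H` classifies every example of `T` correctly. -/
def ConsistentWith {n : ℕ} (H : Set (Fin n)) (T : TrainingSet n) : Prop :=
  ∀ e ∈ T, (e.1 ∈ H ↔ e.2 = true)

/-- `T` is `φ`-consistent over `w`: some parameter tuple for `φ` is consistent with `T`. -/
def MSO.ConsistentSet {A : Type} {ℓ n : ℕ} (φ : MSO A (ℓ + 1) 0) (w : Str A n)
    (T : TrainingSet n) : Prop :=
  ∃ v : Fin ℓ → Fin n, ConsistentWith (φ.concept w v) T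

/-! ## Learners with local access, and their running time -/

/-- What a `(q, ℓ)`-formula learner produces on a string of length `n`: a unary formula of
quantifier rank at most `q` with `ℓ` parameter variables, and a tuple of `ℓ` parameters. -/
structure Hypothesis (A : Type) (q ℓ n : ℕ) where
  formula : MSO A (ℓ + 1) 0
  rank_le : formula.rank ≤ q
  params : Fin ℓ → Fin n

/-- The set of positions selected by a hypothesis over the string `w`. -/
def Hypothesis.concept {A : Type} {q ℓ n : ℕ} (h : Hypothesis A q ℓ n) (w : Str A n) :
    Set (Fin n) :=
  h.formula.concept w h.params

/-- The local moves from a position: to itself, to its successor, to its predecessor. -/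
inductive Move
  | stay
  | next
  | prev

/-- The target of a move, if it exists. -/
def Move.target {n : ℕ} : Move → Fin n → Option (Fin n)
  | stay, p => some p
  | next, p => if h : p.val + 1 < n then some ⟨p.val + 1, h⟩ else none
  | prev, p => if 0 < p.val then some ⟨p.val - 1, lt_of_le_of_lt (Nat.sub_le _ _) p.isLt⟩ else none

/-- The instructions of a learner with internal states `S`.
* `compute s`: pass to the internal state `s`;
* `access p d k`: ask for the letter at the target of the move `d` from the position `p`, and pass
  to the state `k o`, where `o` is the answer;
* `output h`: halt with the hypothesis `h`. -/
inductive Instruction (A : Type) (q ℓ n : ℕ) (S : Type)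
  | compute (s : S) : Instruction A q ℓ n S
  | access (p : Fin n) (d : Move) (k : Option A → S) : Instruction A q ℓ n S
  | output (h : Hypothesis A q ℓ n) : Instruction A q ℓ n S

/-- A `(q, ℓ)`-formula learner for strings over `A`: a deterministic machine that is given the
length `n` of the string and the training set, but can inspect the string itself only through
`access` instructions.  Its internal memory and internal computations are not restricted in any
way, so every concrete kind of algorithm with local access to the string is covered. -/
structure Learner (A : Type) (q ℓ : ℕ) where
  State : ℕ → Type
  init : (n : ℕ) → TrainingSet n → State n
  instr : (n : ℕ) → State n → Instruction A q ℓ n (State n)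

namespace Learner

variable {A : Type} {q ℓ : ℕ}

/-- A configuration: the internal state, and the positions of the string held in memory. -/
structure Config (L : Learner A q ℓ) (n : ℕ) where
  state : L.State n
  held : Finset (Fin n)

/-- Initially the learner holds exactly the positions that occur in the training set. -/
def start (L : Learner A q ℓ) {n : ℕ} (T : TrainingSet n) : L.Config n :=
  ⟨L.init n T, T.image Prod.fst⟩

/-- One step on the string `w`.  An access from a held position whose target exists returns the
letter at the target, which is then held as well; any other access is answered by `none`.
A halting configuration is not changed. -/
def step (L : Learner A q ℓ) {n : ℕ} (w : Str A n) (c : L.Config n) : L.Config n :=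
  match L.instr n c.state with
  | .compute s => ⟨s, c.held⟩
  | .access p d k =>
      if p ∈ c.held then
        match d.target p with
        | some p' => ⟨k (some (w p')), insert p' c.held⟩
        | none => ⟨k none, c.held⟩
      else ⟨k none, c.held⟩
  | .output _ => c

/-- On the string `w` and the training set `T`, the learner `L` halts after at most `s` steps with
the hypothesis `h`. -/
def OutputsWithin (L : Learner A q ℓ) {n : ℕ} (w : Str A n) (T : TrainingSet n) (s : ℕ)
    (h : Hypothesis A q ℓ n) : Prop :=
  L.instr n ((L.step w)^[s] (L.start T)).state = .output h

/-- The learner `L` halts on `w` and `T` with the hypothesis `h`. -/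
def Outputs (L : Learner A q ℓ) {n : ℕ} (w : Str A n) (T : TrainingSet n)
    (h : Hypothesis A q ℓ n) : Prop :=
  ∃ s, L.OutputsWithin w T s h

/-- The running time of `L` as a learner for the formula `φ` is sublinear in the length of the
string: for some `f` such that `f t n = o(n)` for every fixed `t`, the learner halts after at most
`f |T| n` steps on every string of length `n` and every `φ`-consistent training set `T` over it
(the inputs on which a learner for `φ` is supposed to work). -/
def SublinearFor (L : Learner A q ℓ) {ℓ₀ : ℕ} (φ : MSO A (ℓ₀ + 1) 0) : Prop :=
  ∃ f : ℕ → ℕ → ℕ,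
    (∀ t, (fun n : ℕ => (f t n : ℝ)) =o[atTop] (fun n : ℕ => (n : ℝ))) ∧
    ∀ (n : ℕ) (w : Str A n) (T : TrainingSet n), φ.ConsistentSet w T →
      ∃ h, L.OutputsWithin w T (f T.card n) h

/-- `L` is a consistent learner for `φ`: on every string and every `φ`-consistent training set it
produces a hypothesis that is consistent with the training set. -/
def ConsistentFor (L : Learner A q ℓ) {ℓ₀ : ℕ} (φ : MSO A (ℓ₀ + 1) 0) : Prop :=
  ∀ (n : ℕ) (w : Str A n) (T : TrainingSet n), φ.ConsistentSet w T →
    ∃ h, L.Outputs w T h ∧ ConsistentWith (h.concept w) T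

end Learner

/-!
The target formula `target a b`, with two distinguished letters `a` and `b` (the marks), says that
the last mark before `x` is an `a` if `y ≤ x`, and a `b` if `x < y`.  Thus the parameter `y` is the
place where the roles of `a` and `b` are exchanged.

The strings `blockString a b c e t j` consist of `t` blocks of length `2 * e` that are filled with a
third letter `c`; each block but the `j`-th starts with a mark.  The training examples are the
middles of the blocks, labelled alternately.  The marks are chosen such that the labelling is
realized by the target formula with `y` in block `j` (`consistentSet_target_blockString`).  For
fixed `t` and large `e`, a sublinear learner halts after fewer than `e` steps
(`exists_block_length`).  It then sees nothing but the letter `c`, so its output does not depend on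
`j` (`outputsWithin_blockString`).  For `t = 2 * ℓ + 3` there are `2 * ℓ + 2` pairs of consecutive
blocks, and each of the `ℓ` parameters of the output lies in at most two of them; hence there is
such a pair, of blocks `k` and `k + 1`, that contains no parameter (`exists_free_double_block`).
In the string with `j = k + 1`, the middles of these two blocks lie in one long run of `c`s, at
distance at least `e` from its ends.  A monadic second-order formula of bounded quantifier rank
does not distinguish them (`blockMiddle_mem_concept_iff`), but their labels differ.

The last step is the composition method.  The rank-`q` type of a word (`wordType`) takes finitely
many values, is determined on a concatenation by the types of the factors (`wordType_append`), and
determines the truth of all formulas of rank at most `q` (`holds_iff_of_wordType_eq`).  So the types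
of the powers of a letter are ultimately periodic (`exists_period_wordType_replicate`), and if `e`
is large and a multiple of the period, then shifting a position by `2 * e` inside the run does not
change the type of the string (`holds_cons_iff_of_block`).
-/

/-! ### Types of words for monadic second-order logic -/

/-- Letters that carry, besides a letter of `A`, the truth values of "the `i`-th position variable
sits here" and "this position belongs to the `X`-th set variable".  No condition forces a position
variable to sit at exactly one position of a word, so that factors of words are words again. -/
abbrev ExtLetter (A : Type) (k m : ℕ) : Type := A × (Fin k → Prop) × (Fin m → Prop)

namespace ExtLetter

variable {A : Type} {k m : ℕ}

/-- Add a new position variable with index `0`, which sits at this letter iff `P` holds. -/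
def consPos (P : Prop) (σ : ExtLetter A k m) : ExtLetter A (k + 1) m :=
  (σ.1, Fin.cons P σ.2.1, σ.2.2)

/-- Forget the set variable with index `0`. -/
def tailSet (σ : ExtLetter A k (m + 1)) : ExtLetter A k m :=
  (σ.1, σ.2.1, Fin.tail σ.2.2)

end ExtLetter

section Types

variable {A : Type} {k m : ℕ}

/-- The expansions of a word by one further position variable, placed at one position. -/
def posExpansions (u : List (ExtLetter A k m)) : Set (List (ExtLetter A (k + 1) m)) :=
  {u' | ∃ s σ t, u = s ++ σ :: t ∧
    u' = s.map (.consPos False) ++ σ.consPos True :: t.map (.consPos False)}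

/-- The expansions of a word by one further set variable. -/
def setExpansions (u : List (ExtLetter A k m)) : Set (List (ExtLetter A k (m + 1))) :=
  {u' | u'.map .tailSet = u}

theorem mem_posExpansions_append {u v : List (ExtLetter A k m)}
    {x : List (ExtLetter A (k + 1) m)} :
    x ∈ posExpansions (u ++ v) ↔
      (∃ u' ∈ posExpansions u, x = u' ++ v.map (.consPos False)) ∨
      (∃ v' ∈ posExpansions v, x = u.map (.consPos False) ++ v') := by
  constructor
  · rintro ⟨s, σ, t, h, rfl⟩
    rcases List.append_eq_append_iff.1 h with ⟨r, rfl, rfl⟩ | ⟨r, rfl, hr⟩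
    · exact .inr ⟨_, ⟨r, σ, t, rfl, rfl⟩, by simp⟩
    · cases r with
      | nil =>
        obtain rfl : v = σ :: t := by simpa using hr.symm
        exact .inr ⟨_, ⟨[], σ, t, rfl, rfl⟩, by simp⟩
      | cons ρ r =>
        obtain ⟨rfl, rfl⟩ : σ = ρ ∧ t = r ++ v := by simpa using hr
        exact .inl ⟨_, ⟨s, σ, r, rfl, rfl⟩, by simp⟩
  · rintro (⟨_, ⟨s, σ, t, rfl, rfl⟩, rfl⟩ | ⟨_, ⟨s, σ, t, rfl, rfl⟩, rfl⟩)
    · exact ⟨s, σ, t ++ v, by simp, by simp⟩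
    · exact ⟨u ++ s, σ, t, by simp, by simp⟩

theorem mem_setExpansions_append {u v : List (ExtLetter A k m)}
    {x : List (ExtLetter A k (m + 1))} :
    x ∈ setExpansions (u ++ v) ↔
      ∃ u' ∈ setExpansions u, ∃ v' ∈ setExpansions v, x = u' ++ v' := by
  simp only [setExpansions, Set.mem_ofPred_eq, List.map_eq_append_iff]
  constructor
  · rintro ⟨u', v', rfl, hu, hv⟩
    exact ⟨u', hu, v', hv, rfl⟩
  · rintro ⟨u', hu, v', hv, rfl⟩
    exact ⟨u', v', rfl, hu, hv⟩

/-- The set of possible values of `wordType q`. -/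
def MSOType (A : Type) : ℕ → ℕ → ℕ → Type
  | 0, k, m => Set (ExtLetter A k m) × Set (ExtLetter A k m → ExtLetter A k m → Prop)
  | q + 1, k, m => MSOType A q k m × MSOType A q (k + 1) m × Set (MSOType A q (k + 1) m) ×
      Set (MSOType A q k (m + 1))

/-- The rank-`q` type of a word.  In rank `0` it records which letters occur and which relations
hold between each letter and all later ones.  In rank `q + 1` it records the rank-`q` types of all
expansions by one variable; the type of the expansion by a position variable that is placed
nowhere is kept as well, since this is what a factor sees when the variable is placed in another
factor. -/
def wordType : (q k m : ℕ) → List (ExtLetter A k m) → MSOType A q k m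
  | 0, _, _, u => ({σ | σ ∈ u}, {R | u.Pairwise R})
  | q + 1, k, m, u => (wordType q k m u, wordType q (k + 1) m (u.map (.consPos False)),
      wordType q (k + 1) m '' posExpansions u, wordType q k (m + 1) '' setExpansions u)

theorem wordType_zero_eq_iff {u v : List (ExtLetter A k m)} :
    wordType 0 k m u = wordType 0 k m v ↔
      (∀ σ, σ ∈ u ↔ σ ∈ v) ∧
        ∀ R : ExtLetter A k m → ExtLetter A k m → Prop, u.Pairwise R ↔ v.Pairwise R :=
  Prod.ext_iff.trans (and_congr Set.ext_iff Set.ext_iff)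

theorem wordType_succ_eq_iff {q : ℕ} {u v : List (ExtLetter A k m)} :
    wordType (q + 1) k m u = wordType (q + 1) k m v ↔
      wordType q k m u = wordType q k m v ∧
      wordType q (k + 1) m (u.map (.consPos False)) =
        wordType q (k + 1) m (v.map (.consPos False)) ∧
      wordType q (k + 1) m '' posExpansions u = wordType q (k + 1) m '' posExpansions v ∧
      wordType q k (m + 1) '' setExpansions u = wordType q k (m + 1) '' setExpansions v :=
  Prod.ext_iff.trans (and_congr_right' (Prod.ext_iff.trans (and_congr_right' Prod.ext_iff)))

instance MSOType.instFinite [Finite A] (q k m : ℕ) : Finite (MSOType A q k m) := by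
  induction q generalizing k m with
  | zero => unfold MSOType; infer_instance
  | succ q ih =>
    have := ih k m
    have := ih (k + 1) m
    have := ih k (m + 1)
    unfold MSOType; infer_instance

/-- Types are compositional: the type of a concatenation depends only on the types of the
factors. -/
theorem wordType_append (q : ℕ) {k m : ℕ} {u u' v v' : List (ExtLetter A k m)}
    (hu : wordType q k m u = wordType q k m u') (hv : wordType q k m v = wordType q k m v') :
    wordType q k m (u ++ v) = wordType q k m (u' ++ v') := by
  induction q generalizing k m with
  | zero =>
    rw [wordType_zero_eq_iff] at hu hv ⊢
    exact ⟨fun σ ↦ by simp [hu.1, hv.1], fun R ↦ by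
      simp [List.pairwise_append, hu.1, hv.1, hu.2, hv.2]⟩
  | succ q ih =>
    -- By symmetry, only one inclusion is needed for each of the two sets of types.
    have aux : ∀ {u u' v v' : List (ExtLetter A k m)},
        wordType (q + 1) k m u = wordType (q + 1) k m u' →
        wordType (q + 1) k m v = wordType (q + 1) k m v' →
        wordType q (k + 1) m '' posExpansions (u ++ v) ⊆
          wordType q (k + 1) m '' posExpansions (u' ++ v') ∧
        wordType q k (m + 1) '' setExpansions (u ++ v) ⊆
          wordType q k (m + 1) '' setExpansions (u' ++ v') := by
      intro u u' v v' hu hv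
      rw [wordType_succ_eq_iff] at hu hv
      obtain ⟨-, hu0, hu1, hu2⟩ := hu
      obtain ⟨-, hv0, hv1, hv2⟩ := hv
      constructor
      · rintro _ ⟨x, hx, rfl⟩
        rcases mem_posExpansions_append.1 hx with ⟨y, hy, rfl⟩ | ⟨y, hy, rfl⟩
        · obtain ⟨z, hz, hzy⟩ := hu1.subset (Set.mem_image_of_mem _ hy)
          exact ⟨_, mem_posExpansions_append.2 (.inl ⟨z, hz, rfl⟩), ih hzy hv0.symm⟩
        · obtain ⟨z, hz, hzy⟩ := hv1.subset (Set.mem_image_of_mem _ hy)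
          exact ⟨_, mem_posExpansions_append.2 (.inr ⟨z, hz, rfl⟩), ih hu0.symm hzy⟩
      · rintro _ ⟨x, hx, rfl⟩
        obtain ⟨y, hy, y', hy', rfl⟩ := mem_setExpansions_append.1 hx
        obtain ⟨z, hz, hzy⟩ := hu2.subset (Set.mem_image_of_mem _ hy)
        obtain ⟨z', hz', hzy'⟩ := hv2.subset (Set.mem_image_of_mem _ hy')
        exact ⟨_, mem_setExpansions_append.2 ⟨z, hz, z', hz', rfl⟩, ih hzy hzy'⟩
    have h₁ := aux hu hv
    have h₂ := aux hu.symm hv.symm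
    rw [wordType_succ_eq_iff] at hu hv ⊢
    refine ⟨ih hu.1 hv.1, ?_, h₁.1.antisymm h₂.1, h₁.2.antisymm h₂.2⟩
    rw [List.map_append, List.map_append]
    exact ih hu.2.1 hv.2.1

/-- The word over extended letters that represents a string with an assignment. -/
def encode {n : ℕ} (w : Str A n) (v : Fin k → Fin n) (V : Fin m → Set (Fin n)) :
    List (ExtLetter A k m) :=
  List.ofFn fun i ↦ (w i, fun j ↦ v j = i, fun X ↦ i ∈ V X)

theorem posExpansions_encode {n : ℕ} (w : Str A n) (v : Fin k → Fin n) (V : Fin m → Set (Fin n)) :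
    posExpansions (encode w v V) =
      Set.range fun p ↦ encode w (Fin.cons p v : Fin (k + 1) → Fin n) V := by
  have key : ∀ (p : Fin n) (s t : List (ExtLetter A k m)) (σ : ExtLetter A k m),
      encode w v V = s ++ σ :: t → s.length = p →
      encode w (Fin.cons p v : Fin (k + 1) → Fin n) V =
        s.map (.consPos False) ++ σ.consPos True :: t.map (.consPos False) := by
    intro p s t σ h hs
    have hlen : n = s.length + (t.length + 1) := by
      have := congrArg List.length h
      simpa [encode] using this
    apply List.ext_getElem
    · simp [encode, hlen, add_assoc]
    · intro i h₁ h₂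
      have hi : i < n := by simpa [encode] using h₁
      have hget : (encode w v V)[i]'(by simpa [encode] using hi) =
          (s ++ σ :: t)[i]'(by simp; omega) := by simp only [h]
      have hmain : (encode w (Fin.cons p v : Fin (k + 1) → Fin n) V)[i] =
          ExtLetter.consPos (i = s.length) ((s ++ σ :: t)[i]'(by simp; omega)) := by
        rw [← hget]
        simp only [encode, List.getElem_ofFn, ExtLetter.consPos, Prod.mk.injEq, true_and,
          and_true]
        funext j
        refine Fin.cases ?_ (fun j ↦ ?_) j
        · simp [Fin.ext_iff, hs, eq_comm]
        · simp
      rw [hmain]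
      rcases lt_trichotomy i s.length with hlt | rfl | hgt
      · simp [List.getElem_append_left, hlt, hlt.ne]
      · simp
      · obtain ⟨r, rfl⟩ := Nat.exists_eq_add_of_lt hgt
        have hne : ¬ (s.length + r + 1 = s.length) := by omega
        simp [List.getElem_append_right, add_assoc]
  ext x
  constructor
  · rintro ⟨s, σ, t, h, rfl⟩
    have hlen : n = s.length + (t.length + 1) := by
      have := congrArg List.length h
      simpa [encode] using this
    exact ⟨⟨s.length, by omega⟩, key _ s t σ h rfl⟩
  · rintro ⟨p, rfl⟩
    have hp : (p : ℕ) < (encode w v V).length := by simp [encode]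
    have h := List.take_append_drop (p : ℕ) (encode w v V)
    rw [List.drop_eq_getElem_cons hp] at h
    exact ⟨_, _, _, h.symm, key p _ _ _ h.symm (by simp [hp.le])⟩

theorem setExpansions_encode {n : ℕ} (w : Str A n) (v : Fin k → Fin n) (V : Fin m → Set (Fin n)) :
    setExpansions (encode w v V) =
      Set.range fun P ↦ encode w v (Fin.cons P V : Fin (m + 1) → Set (Fin n)) := by
  ext x
  constructor
  · intro h
    replace h : x.map .tailSet = encode w v V := h
    have hlen : x.length = n := by simpa [encode] using congrArg List.length h
    refine ⟨{i | (x[i.1]'(by omega)).2.2 0}, ?_⟩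
    apply List.ext_getElem
    · simp [encode, hlen]
    · intro i h₁ h₂
      have hi : i < n := by omega
      have hget : (x[i]).tailSet = (encode w v V)[i]'(by simpa [encode] using hi) := by
        simp only [← h, List.getElem_map]
      simp only [encode, List.getElem_ofFn, ExtLetter.tailSet, Prod.ext_iff] at hget ⊢
      refine ⟨hget.1.symm, hget.2.1.symm, ?_⟩
      funext j
      refine Fin.cases ?_ (fun j ↦ ?_) j
      · simp
      · simpa [Fin.tail] using (congrFun hget.2.2 j).symm
  · rintro ⟨P, rfl⟩
    change List.map _ (encode _ _ _) = _
    simp only [encode, List.map_ofFn]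
    congr 1

theorem wordType_zero_eq {q : ℕ} {u v : List (ExtLetter A k m)}
    (h : wordType q k m u = wordType q k m v) : wordType 0 k m u = wordType 0 k m v := by
  induction q with
  | zero => exact h
  | succ q ih => exact ih (wordType_succ_eq_iff.1 h).1

section Holds

variable {n n' : ℕ} {w : Str A n} {w' : Str A n'} {q : ℕ} {v : Fin k → Fin n}
  {V : Fin m → Set (Fin n)} {v' : Fin k → Fin n'} {V' : Fin m → Set (Fin n')}

/-- Statements about a single position only depend on the set of letters that occur. -/
theorem exists_letter_iff_of_wordType_eq
    (h : wordType q k m (encode w v V) = wordType q k m (encode w' v' V'))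
    (Q : ExtLetter A k m → Prop) :
    (∃ i, Q (w i, fun j ↦ v j = i, fun X ↦ i ∈ V X)) ↔
      ∃ i, Q (w' i, fun j ↦ v' j = i, fun X ↦ i ∈ V' X) := by
  have : (∃ σ ∈ encode w v V, Q σ) ↔ ∃ σ ∈ encode w' v' V', Q σ := by
    simp only [(wordType_zero_eq_iff.1 (wordType_zero_eq h)).1]
  simpa [encode, List.mem_ofFn] using this

theorem lt_iff_of_wordType_eq
    (h : wordType q k m (encode w v V) = wordType q k m (encode w' v' V')) (i j : Fin k) :
    v i < v j ↔ v' i < v' j := by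
  have := (wordType_zero_eq_iff.1 (wordType_zero_eq h)).2 fun σ τ ↦ ¬ (σ.2.1 i ∧ τ.2.1 j)
  simp only [encode, List.pairwise_ofFn] at this
  have := not_congr this
  push Not at this
  simpa using this

theorem exists_pos_of_wordType_eq
    (h : wordType (q + 1) k m (encode w v V) = wordType (q + 1) k m (encode w' v' V'))
    (p : Fin n) :
    ∃ p' : Fin n', wordType q (k + 1) m (encode w (Fin.cons p v : Fin (k + 1) → Fin n) V) =
      wordType q (k + 1) m (encode w' (Fin.cons p' v' : Fin (k + 1) → Fin n') V') := by
  have h := (wordType_succ_eq_iff.1 h).2.2.1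
  rw [posExpansions_encode, posExpansions_encode] at h
  obtain ⟨_, ⟨p', rfl⟩, hp'⟩ := h.subset (Set.mem_image_of_mem _ ⟨p, rfl⟩)
  exact ⟨p', hp'.symm⟩

theorem exists_set_of_wordType_eq
    (h : wordType (q + 1) k m (encode w v V) = wordType (q + 1) k m (encode w' v' V'))
    (P : Set (Fin n)) :
    ∃ P' : Set (Fin n'),
      wordType q k (m + 1) (encode w v (Fin.cons P V : Fin (m + 1) → Set (Fin n))) =
        wordType q k (m + 1) (encode w' v' (Fin.cons P' V' : Fin (m + 1) → Set (Fin n'))) := by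
  have h := (wordType_succ_eq_iff.1 h).2.2.2
  rw [setExpansions_encode, setExpansions_encode] at h
  obtain ⟨_, ⟨P', rfl⟩, hP'⟩ := h.subset (Set.mem_image_of_mem _ ⟨P, rfl⟩)
  exact ⟨P', hP'.symm⟩

end Holds

/-- A formula of rank at most `q` cannot distinguish two strings with assignments of the same
rank-`q` type. -/
theorem holds_iff_of_wordType_eq {n n' : ℕ} {w : Str A n} {w' : Str A n'} {q k m : ℕ}
    (φ : MSO A k m) (hφ : φ.rank ≤ q) {v : Fin k → Fin n} {V : Fin m → Set (Fin n)}
    {v' : Fin k → Fin n'} {V' : Fin m → Set (Fin n')}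
    (h : wordType q k m (encode w v V) = wordType q k m (encode w' v' V')) :
    φ.Holds w v V ↔ φ.Holds w' v' V' := by
  induction φ generalizing q with
  | bot => simp [MSO.Holds]
  | eq i j =>
    simpa [MSO.Holds, eq_comm] using
      exists_letter_iff_of_wordType_eq h fun σ ↦ σ.2.1 i ∧ σ.2.1 j
  | lt i j => exact lt_iff_of_wordType_eq h i j
  | letter a i =>
    simpa [MSO.Holds] using exists_letter_iff_of_wordType_eq h fun σ ↦ σ.1 = a ∧ σ.2.1 i
  | mem i X =>
    simpa [MSO.Holds] using exists_letter_iff_of_wordType_eq h fun σ ↦ σ.2.1 i ∧ σ.2.2 X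
  | not φ ih => exact not_congr (ih hφ h)
  | and φ ψ ih₁ ih₂ =>
    exact and_congr (ih₁ (le_trans (le_max_left _ _) hφ) h)
      (ih₂ (le_trans (le_max_right _ _) hφ) h)
  | or φ ψ ih₁ ih₂ =>
    exact or_congr (ih₁ (le_trans (le_max_left _ _) hφ) h)
      (ih₂ (le_trans (le_max_right _ _) hφ) h)
  | ex φ ih =>
    obtain ⟨q, rfl⟩ := Nat.exists_eq_add_of_le' (le_trans (Nat.le_add_left 1 _) hφ)
    have hφ' : φ.rank ≤ q := Nat.le_of_succ_le_succ hφ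
    constructor
    · rintro ⟨p, hp⟩
      obtain ⟨p', hp'⟩ := exists_pos_of_wordType_eq h p
      exact ⟨p', (ih hφ' hp').1 hp⟩
    · rintro ⟨p, hp⟩
      obtain ⟨p', hp'⟩ := exists_pos_of_wordType_eq h.symm p
      exact ⟨p', (ih hφ' hp'.symm).2 hp⟩
  | all φ ih =>
    obtain ⟨q, rfl⟩ := Nat.exists_eq_add_of_le' (le_trans (Nat.le_add_left 1 _) hφ)
    have hφ' : φ.rank ≤ q := Nat.le_of_succ_le_succ hφ
    constructor
    · intro H p
      obtain ⟨p', hp'⟩ := exists_pos_of_wordType_eq h.symm p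
      exact (ih hφ' hp'.symm).1 (H p')
    · intro H p
      obtain ⟨p', hp'⟩ := exists_pos_of_wordType_eq h p
      exact (ih hφ' hp').2 (H p')
  | exSet φ ih =>
    obtain ⟨q, rfl⟩ := Nat.exists_eq_add_of_le' (le_trans (Nat.le_add_left 1 _) hφ)
    have hφ' : φ.rank ≤ q := Nat.le_of_succ_le_succ hφ
    constructor
    · rintro ⟨P, hP⟩
      obtain ⟨P', hP'⟩ := exists_set_of_wordType_eq h P
      exact ⟨P', (ih hφ' hP').1 hP⟩
    · rintro ⟨P, hP⟩
      obtain ⟨P', hP'⟩ := exists_set_of_wordType_eq h.symm P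
      exact ⟨P', (ih hφ' hP'.symm).2 hP⟩
  | allSet φ ih =>
    obtain ⟨q, rfl⟩ := Nat.exists_eq_add_of_le' (le_trans (Nat.le_add_left 1 _) hφ)
    have hφ' : φ.rank ≤ q := Nat.le_of_succ_le_succ hφ
    constructor
    · intro H P
      obtain ⟨P', hP'⟩ := exists_set_of_wordType_eq h.symm P
      exact (ih hφ' hP'.symm).1 (H P')
    · intro H P
      obtain ⟨P', hP'⟩ := exists_set_of_wordType_eq h P
      exact (ih hφ' hP').2 (H P')

/-- The types of the powers of a letter are ultimately periodic. -/
theorem exists_period_wordType_replicate [Finite A] (q : ℕ) (σ : ExtLetter A k m) :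
    ∃ N K : ℕ, 0 < K ∧ ∀ s r, N ≤ s →
      wordType q k m (List.replicate (s + K * r) σ) = wordType q k m (List.replicate s σ) := by
  obtain ⟨i, i', hlt, heq⟩ := Finite.exists_ne_map_eq_of_infinite
    fun i : ℕ ↦ wordType q k m (List.replicate i σ)
  wlog h : i < i' generalizing i i'
  · exact this i' i hlt.symm heq.symm (lt_of_le_of_ne (not_lt.1 h) hlt.symm)
  refine ⟨i, i' - i, Nat.sub_pos_of_lt h, fun s r hs ↦ ?_⟩
  induction r with
  | zero => rfl
  | succ r ih =>
    rw [← ih]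
    have h₁ : s + (i' - i) * (r + 1) = i' + (s + (i' - i) * r - i) := by
      rw [mul_add]; omega
    have h₂ : s + (i' - i) * r = i + (s + (i' - i) * r - i) := by omega
    rw [h₁, List.replicate_add]
    conv_rhs => rw [h₂, List.replicate_add]
    exact wordType_append q heq.symm rfl

theorem List.eq_take_append_replicate_append {α : Type*} {U : List α} {a s s' : ℕ} {σ τ : α}
    (h₁ : ∀ i, a ≤ i → i < a + s → U[i]? = some σ) (h₂ : U[a + s]? = some τ)
    (h₃ : ∀ i, a + s < i → i ≤ a + s + s' → U[i]? = some σ) :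
    U = U.take a ++ (List.replicate s σ ++
      ([τ] ++ (List.replicate s' σ ++ U.drop (a + s + s' + 1)))) := by
  have ha : a + s < U.length := (List.getElem?_eq_some_iff.1 h₂).1
  apply List.ext_getElem?
  intro i
  rw [List.getElem?_append, List.getElem?_append, List.getElem?_append, List.getElem?_append]
  simp only [List.length_take, List.length_replicate, List.length_singleton,
    min_eq_left (show a ≤ U.length by omega)]
  split_ifs with g₁ g₂ g₃ g₄
  · rw [List.getElem?_take_of_lt g₁]
  · rw [h₁ i (by omega) (by omega), List.getElem?_replicate_of_lt g₂]
  · obtain rfl : i = a + s := by omega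
    simp [h₂]
  · rw [h₃ i (by omega) (by omega), List.getElem?_replicate_of_lt g₄]
  · rw [List.getElem?_drop]
    congr 1
    omega

/-- Inside a long block of equal letters, a formula of bounded rank cannot tell two positions
apart whose distance is a multiple of the period of the types of such blocks, provided that both
are far from the ends of the block and no parameter lies in the block. -/
theorem holds_cons_iff_of_block {q n ℓ N K : ℕ} {w : Str A n} {c : A} {v : Fin ℓ → Fin n}
    (hper : ∀ s r, N ≤ s →
      wordType q (ℓ + 1) 0 (List.replicate (s + K * r) (c, fun _ ↦ False, Fin.elim0)) =
        wordType q (ℓ + 1) 0 (List.replicate s (c, fun _ ↦ False, Fin.elim0)))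
    {φ : MSO A (ℓ + 1) 0} (hφ : φ.rank ≤ q) {s r : ℕ} (hs : N ≤ s) {p p' : Fin n}
    (hpp' : (p' : ℕ) = p + K * r) (hp : s ≤ p) (hp' : p' + s < n)
    (hw : ∀ i : Fin n, (p : ℕ) ≤ i + s → (i : ℕ) ≤ p' + s → w i = c)
    (hv : ∀ j, (v j : ℕ) + s < p ∨ p' + s < v j) :
    φ.Holds w (Fin.cons p v : Fin (ℓ + 1) → Fin n) Fin.elim0 ↔
      φ.Holds w (Fin.cons p' v : Fin (ℓ + 1) → Fin n) Fin.elim0 := by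
  refine holds_iff_of_wordType_eq φ hφ ?_
  set σ : ExtLetter A (ℓ + 1) 0 := (c, fun _ ↦ False, Fin.elim0) with hσ
  set τ : ExtLetter A (ℓ + 1) 0 := (c, Fin.cons True fun _ ↦ False, Fin.elim0) with hτ
  have hget : ∀ (x i : Fin n),
      (encode w (Fin.cons x v : Fin (ℓ + 1) → Fin n) Fin.elim0)[(i : ℕ)]? =
        some (w i, Fin.cons (x = i) fun j ↦ v j = i, Fin.elim0) := by
    intro x i
    rw [encode, List.getElem?_ofFn, dif_pos i.isLt]
    refine congrArg some (Prod.ext rfl (Prod.ext ?_ (Subsingleton.elim _ _)))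
    funext j
    refine Fin.cases ?_ (fun j ↦ ?_) j <;> simp
  have hblock : ∀ (x i : Fin n), (p : ℕ) ≤ i + s → (i : ℕ) ≤ p' + s →
      (encode w (Fin.cons x v : Fin (ℓ + 1) → Fin n) Fin.elim0)[(i : ℕ)]? =
        some (c, Fin.cons (x = i) fun _ ↦ False, Fin.elim0) := by
    intro x i hi hi'
    rw [hget, hw i hi hi']
    have : ∀ j, v j ≠ i := by
      rintro j rfl
      rcases hv j with h | h <;> omega
    simp only [this]
  have hσ' : ∀ (x i : Fin n), (p : ℕ) ≤ i + s → (i : ℕ) ≤ p' + s → x ≠ i →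
      (encode w (Fin.cons x v : Fin (ℓ + 1) → Fin n) Fin.elim0)[(i : ℕ)]? = some σ := by
    intro x i hi hi' hx
    rw [hblock x i hi hi', hσ]
    refine congrArg some (Prod.ext rfl (Prod.ext ?_ rfl))
    funext j
    refine Fin.cases ?_ (fun j ↦ ?_) j <;> simp [hx]
  have hτ' : ∀ x : Fin n, (p : ℕ) ≤ x → (x : ℕ) ≤ p' →
      (encode w (Fin.cons x v : Fin (ℓ + 1) → Fin n) Fin.elim0)[(x : ℕ)]? = some τ := by
    intro x hx hx'
    rw [hblock x x (by omega) (by omega), hτ, eq_self]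
  -- Outside of the block the two words agree.
  have hout : ∀ i : ℕ, i ≠ p → i ≠ p' →
      (encode w (Fin.cons p v : Fin (ℓ + 1) → Fin n) Fin.elim0)[i]? =
        (encode w (Fin.cons p' v : Fin (ℓ + 1) → Fin n) Fin.elim0)[i]? := by
    intro i h h'
    by_cases hi : i < n
    · have e := hget p ⟨i, hi⟩
      have e' := hget p' ⟨i, hi⟩
      simp only [Fin.ext_iff] at e e'
      rw [e, e']
      simp only [h.symm, h'.symm]
    · rw [List.getElem?_eq_none (by simpa [encode] using hi),
        List.getElem?_eq_none (by simpa [encode] using hi)]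
  rw [List.eq_take_append_replicate_append (a := p - s) (s := s) (s' := s + K * r) (σ := σ)
      (τ := τ) (U := encode w (Fin.cons p v : Fin (ℓ + 1) → Fin n) Fin.elim0)
      (fun i hi hi' ↦ hσ' p ⟨i, by omega⟩ (by dsimp; omega) (by dsimp; omega)
        (by rw [Ne, Fin.ext_iff]; dsimp; omega))
      (by rw [Nat.sub_add_cancel hp]; exact hτ' p le_rfl (by omega))
      (fun i hi hi' ↦ hσ' p ⟨i, by omega⟩ (by dsimp; omega) (by dsimp; omega)
        (by rw [Ne, Fin.ext_iff]; dsimp; omega)),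
    List.eq_take_append_replicate_append (a := p - s) (s := s + K * r) (s' := s) (σ := σ)
      (τ := τ) (U := encode w (Fin.cons p' v : Fin (ℓ + 1) → Fin n) Fin.elim0)
      (fun i hi hi' ↦ hσ' p' ⟨i, by omega⟩ (by dsimp; omega) (by dsimp; omega)
        (by rw [Ne, Fin.ext_iff]; dsimp; omega))
      (by
        rw [show p - s + (s + K * r) = (p' : ℕ) by omega]
        exact hτ' p' (by omega) le_rfl)
      (fun i hi hi' ↦ hσ' p' ⟨i, by omega⟩ (by dsimp; omega) (by dsimp; omega)
        (by rw [Ne, Fin.ext_iff]; dsimp; omega))]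
  refine wordType_append q (congrArg _ ?_) (wordType_append q (hper s r hs).symm
    (wordType_append q rfl (wordType_append q (hper s r hs) (congrArg _ ?_))))
  · apply List.ext_getElem?
    intro i
    rw [List.getElem?_take, List.getElem?_take]
    split_ifs with hi
    · exact hout i (by omega) (by omega)
    · rfl
  · apply List.ext_getElem?
    intro i
    rw [List.getElem?_drop, List.getElem?_drop,
      show p - s + (s + K * r) + s + 1 + i = p - s + s + (s + K * r) + 1 + i by omega]
    exact hout _ (by omega) (by omega)

end Types

/-! ### Runs of a learner -/

theorem Move.target_dist {d : Move} {p p' : Fin n} (h : d.target p = some p') :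
    (p' : ℕ) ≤ p + 1 ∧ (p : ℕ) ≤ p' + 1 := by
  cases d with
  | stay => obtain rfl : p = p' := by simpa [Move.target] using h
            omega
  | next =>
    simp only [Move.target, Option.dite_none_right_eq_some, Option.some.injEq] at h
    obtain ⟨_, rfl⟩ := h
    dsimp; omega
  | prev =>
    simp only [Move.target, Option.ite_none_right_eq_some,
      Option.some.injEq] at h
    obtain ⟨_, rfl⟩ := h
    dsimp; omega

namespace Learner

variable {A : Type} {q ℓ n : ℕ} {L : Learner A q ℓ}

theorem step_iterate_of_output {w : Str A n} {c : L.Config n} {h : Hypothesis A q ℓ n}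
    (hc : L.instr n c.state = .output h) (s : ℕ) : (L.step w)^[s] c = c :=
  Function.iterate_fixed (by simp [step, hc]) s

theorem OutputsWithin.mono {w : Str A n} {T : TrainingSet n} {s s' : ℕ} {h : Hypothesis A q ℓ n}
    (hs : s ≤ s') (hh : L.OutputsWithin w T s h) : L.OutputsWithin w T s' h := by
  obtain ⟨r, rfl⟩ := Nat.exists_eq_add_of_le' hs
  unfold OutputsWithin at hh ⊢
  rw [Function.iterate_add_apply, step_iterate_of_output hh, hh]

theorem Outputs.unique {w : Str A n} {T : TrainingSet n} {h h' : Hypothesis A q ℓ n}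
    (hh : L.Outputs w T h) (hh' : L.Outputs w T h') : h = h' := by
  obtain ⟨s, hs⟩ := hh
  obtain ⟨s', hs'⟩ := hh'
  have h₁ := hs.mono (le_max_left s s')
  have h₂ := hs'.mono (le_max_right s s')
  exact Instruction.output.inj (h₁.symm.trans h₂)

/-- After `s` steps a learner holds only positions at distance at most `s` from the training set,
so its run is the same on two strings that agree on these positions. -/
theorem step_iterate_start_congr {w w' : Str A n} {T : TrainingSet n} {s : ℕ}
    (hw : ∀ e ∈ T, ∀ p : Fin n, (p : ℕ) ≤ e.1 + s → (e.1 : ℕ) ≤ p + s → w p = w' p) :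
    (L.step w)^[s] (L.start T) = (L.step w')^[s] (L.start T) ∧
      ∀ p ∈ ((L.step w)^[s] (L.start T)).held,
        ∃ e ∈ T, (p : ℕ) ≤ e.1 + s ∧ (e.1 : ℕ) ≤ p + s := by
  induction s with
  | zero =>
    refine ⟨rfl, fun p hp ↦ ?_⟩
    obtain ⟨e, he, rfl⟩ := Finset.mem_image.1 hp
    exact ⟨e, he, le_rfl, le_rfl⟩
  | succ s ih =>
    obtain ⟨heq, hheld⟩ := ih fun e he p h₁ h₂ ↦ hw e he p (by omega) (by omega)
    rw [Function.iterate_succ_apply', Function.iterate_succ_apply', ← heq]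
    generalize (L.step w)^[s] (L.start T) = c at hheld
    have hheld' : ∀ p ∈ c.held, ∃ e ∈ T, (p : ℕ) ≤ e.1 + (s + 1) ∧ (e.1 : ℕ) ≤ p + (s + 1) := by
      intro p hp
      obtain ⟨e, he, h₁, h₂⟩ := hheld p hp
      exact ⟨e, he, by omega, by omega⟩
    unfold step
    cases L.instr n c.state with
    | compute s => exact ⟨rfl, hheld'⟩
    | output h => exact ⟨rfl, hheld'⟩
    | access p d k =>
      dsimp only
      split_ifs with hp
      · obtain ⟨e, he, h₁, h₂⟩ := hheld p hp
        cases htarget : d.target p with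
        | none => exact ⟨rfl, hheld'⟩
        | some p' =>
          have hdist := Move.target_dist htarget
          dsimp only
          refine ⟨by rw [hw e he p' (by omega) (by omega)], fun x hx ↦ ?_⟩
          rcases Finset.mem_insert.1 hx with rfl | hx
          · exact ⟨e, he, by omega, by omega⟩
          · exact hheld' x hx
      · exact ⟨rfl, hheld'⟩

theorem OutputsWithin.congr {w w' : Str A n} {T : TrainingSet n} {s : ℕ}
    {h : Hypothesis A q ℓ n}
    (hw : ∀ e ∈ T, ∀ p : Fin n, (p : ℕ) ≤ e.1 + s → (e.1 : ℕ) ≤ p + s → w p = w' p)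
    (hh : L.OutputsWithin w T s h) : L.OutputsWithin w' T s h := by
  unfold OutputsWithin at hh ⊢
  rw [← (step_iterate_start_congr hw).1, hh]

end Learner

/-! ### The target formula -/

section Target

variable {A : Type}

/-- The quantifier-free part `ψ(z', z, x, y)` of the target formula: `z` is a position before `x`,
the position `z'` is not a mark (a letter `a` or `b`) between `z` and `x`, and either `z` carries
`a` and `y ≤ x`, or `z` carries `b` and `x < y`. -/
def targetMatrix (a b : A) : MSO A 4 0 :=
  .and (.lt 1 2)
    (.and (.or (.not (.and (.lt 1 0) (.lt 0 2))) (.not (.or (.letter a 0) (.letter b 0))))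
      (.or (.and (.letter a 1) (.not (.lt 2 3))) (.and (.letter b 1) (.lt 2 3))))

/-- The target formula `∃ z ∀ z' ψ`: the last mark before `x` is `a` if `y ≤ x`, and `b` if
`x < y`. -/
def target (a b : A) : MSO A (1 + 1) 0 := .ex (.all (targetMatrix a b))

theorem mem_concept_target {a b : A} {n : ℕ} {w : Str A n} {v : Fin 1 → Fin n} {x : Fin n} :
    x ∈ (target a b).concept w v ↔
      ∃ z, ∀ z', z < x ∧ (¬ (z < z' ∧ z' < x) ∨ ¬ (w z' = a ∨ w z' = b)) ∧
        ((w z = a ∧ ¬ x < v 0) ∨ (w z = b ∧ x < v 0)) :=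
  Iff.rfl

theorem mem_concept_target_iff {a b : A} {n : ℕ} {w : Str A n} {v : Fin 1 → Fin n} {x μ : Fin n}
    (hμ : μ < x) (hmark : w μ = a ∨ w μ = b)
    (hlast : ∀ z, μ < z → z < x → w z ≠ a ∧ w z ≠ b) :
    x ∈ (target a b).concept w v ↔ (w μ = a ∧ ¬ x < v 0) ∨ (w μ = b ∧ x < v 0) := by
  rw [mem_concept_target]
  constructor
  · rintro ⟨z, hz⟩
    obtain ⟨hzx, -, hlab⟩ := hz z
    have hzmark : w z = a ∨ w z = b := hlab.imp And.left And.left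
    obtain rfl : z = μ := by
      rcases lt_trichotomy z μ with h | h | h
      · rcases (hz μ).2.1 with h' | h'
        · exact absurd ⟨h, hμ⟩ h'
        · exact absurd hmark h'
      · exact h
      · have := hlast z h hzx
        tauto
    exact hlab
  · intro h
    refine ⟨μ, fun z' ↦ ⟨hμ, ?_, h⟩⟩
    by_cases hz : μ < z' ∧ z' < x
    · have := hlast z' hz.1 hz.2
      tauto
    · exact .inl hz

end Target

/-! ### The strings and the training set -/

section Adversary

variable {A : Type} (a b c : A) (e t j : ℕ)

open Classical in
/-- A string of `t` blocks of length `2 * e`.  Each block but the `j`-th starts with a mark, and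
all other letters are `c`.  The letters of the marks, in the order of their positions, alternate.
As block `j` has no mark, this exchanges the roles of `a` and `b` relative to the parity of the
block number: the mark of an even block is `b` before block `j` and `a` after it. -/
noncomputable def blockString : Str A (2 * e * t) := fun p ↦
  if (p : ℕ) % (2 * e) = 0 ∧ (p : ℕ) / (2 * e) ≠ j then
    if Even ((p : ℕ) / (2 * e)) ↔ (p : ℕ) / (2 * e) < j then b else a
  else c

variable {a b c e t j}

theorem blockString_of_lt_of_lt {p : Fin (2 * e * t)} {i : ℕ} (h₁ : 2 * e * i < p)
    (h₂ : (p : ℕ) < 2 * e * (i + 1)) : blockString a b c e t j p = c := by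
  have hdiv : (p : ℕ) / (2 * e) = i := Nat.div_eq_of_lt_le (by linarith) (by linarith)
  have hmod := Nat.div_add_mod (p : ℕ) (2 * e)
  rw [hdiv] at hmod
  exact if_neg fun h ↦ by omega

theorem blockString_start_self {p : Fin (2 * e * t)} (he : 0 < e) (hp : (p : ℕ) = 2 * e * j) :
    blockString a b c e t j p = c := by
  refine if_neg fun h ↦ h.2 ?_
  rw [hp, Nat.mul_div_cancel_left _ (by omega)]

open Classical in
theorem blockString_start {p : Fin (2 * e * t)} {i : ℕ} (he : 0 < e) (hp : (p : ℕ) = 2 * e * i)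
    (hij : i ≠ j) : blockString a b c e t j p = if Even i ↔ i < j then b else a := by
  have hdiv : (p : ℕ) / (2 * e) = i := by rw [hp, Nat.mul_div_cancel_left _ (by omega)]
  rw [blockString, hdiv, if_pos ⟨by rw [hp, Nat.mul_mod_right], hij⟩]

theorem blockString_double_block {p : Fin (2 * e * t)} {k : ℕ} (he : 0 < e)
    (h₁ : 2 * e * k < p) (h₂ : (p : ℕ) < 2 * e * (k + 2)) :
    blockString a b c e t (k + 1) p = c := by
  rcases lt_trichotomy (p : ℕ) (2 * e * (k + 1)) with h | h | h
  · exact blockString_of_lt_of_lt h₁ h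
  · exact blockString_start_self he h
  · exact blockString_of_lt_of_lt h h₂

/-- The middle of the `i`-th block. -/
def blockMiddle (he : 0 < e) (i : Fin t) : Fin (2 * e * t) :=
  ⟨2 * e * i + e, by
    have : 2 * e * (i + 1) ≤ 2 * e * t := Nat.mul_le_mul_left _ i.isLt
    rw [mul_add, mul_one] at this
    omega⟩

/-- The middles of all blocks, labelled positive and negative in turn. -/
def alternatingSet (he : 0 < e) : TrainingSet (2 * e * t) :=
  Finset.univ.image fun i : Fin t ↦ (blockMiddle he i, decide (Even (i : ℕ)))

theorem blockMiddle_lt_iff (he : 0 < e) {i i' : Fin t} :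
    blockMiddle he i < blockMiddle he i' ↔ (i : ℕ) < i' := by
  simp only [blockMiddle, Fin.mk_lt_mk, add_lt_add_iff_right]
  exact mul_lt_mul_iff_right₀ (by omega)

theorem card_alternatingSet (he : 0 < e) : (alternatingSet (t := t) he).card = t := by
  rw [alternatingSet, Finset.card_image_of_injective, Finset.card_univ, Fintype.card_fin]
  intro i i' h
  have h := (Prod.ext_iff.1 h).1
  have h₁ := (blockMiddle_lt_iff he (i := i) (i' := i')).not.1 h.not_lt
  have h₂ := (blockMiddle_lt_iff he (i := i') (i' := i)).not.1 h.symm.not_lt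
  omega

/-- The parameter in the middle of block `j` realizes the alternating labels: the mark of a positive
example is `b` before block `j` and `a` after it, as the target formula requires.  The last mark
before the middle of block `j` is that of the preceding block, whose label is the opposite one. -/
theorem consistentSet_target_blockString (hab : a ≠ b) (hac : a ≠ c) (hbc : b ≠ c) (he : 0 < e)
    (hj : 0 < j) (hjt : j < t) :
    (target a b).ConsistentSet (blockString a b c e t j) (alternatingSet he) := by
  classical
  refine ⟨fun _ ↦ blockMiddle he ⟨j, hjt⟩, fun x hx ↦ ?_⟩
  obtain ⟨i, -, rfl⟩ := Finset.mem_image.1 hx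
  have hlt := blockMiddle_lt_iff he (i := i) (i' := ⟨j, hjt⟩)
  have hi : 2 * e * (i : ℕ) + e < 2 * e * t := (blockMiddle he i).isLt
  -- `μ` is the last mark before the example; only for `i = j` it belongs to the preceding block.
  by_cases hij : (i : ℕ) = j
  · obtain ⟨k, rfl⟩ := Nat.exists_eq_add_of_lt hj
    simp only [zero_add] at *
    have hk : 2 * e * (k + 1) = 2 * e * k + 2 * e := by ring
    have hk' : 2 * e * (k + 2) = 2 * e * k + 2 * e + 2 * e := by ring
    rw [hij, hk] at hi
    have hμ := blockString_start (a := a) (b := b) (c := c) (t := t) (j := k + 1)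
      (p := ⟨2 * e * k, by omega⟩) he rfl (by omega)
    rw [mem_concept_target_iff (μ := ⟨2 * e * k, by omega⟩), hlt, hμ]
    · simp only [hij, decide_eq_true_eq, Nat.even_add_one, Nat.lt_succ_self, iff_true]
      split_ifs with h <;> simp [h, hab, hab.symm]
    · simp only [blockMiddle, Fin.mk_lt_mk, hij]
      omega
    · rw [hμ]
      split_ifs <;> simp
    · intro z hz hz'
      simp only [blockMiddle, Fin.lt_def, hij] at hz hz'
      rw [blockString_double_block he hz (by omega)]
      exact ⟨hac.symm, hbc.symm⟩
  · have hμ := blockString_start (a := a) (b := b) (c := c) (t := t) (j := j)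
      (p := ⟨2 * e * i, by omega⟩) he rfl hij
    rw [mem_concept_target_iff (μ := ⟨2 * e * i, by omega⟩), hlt, hμ]
    · simp only [decide_eq_true_eq]
      split_ifs with h
      · simp [hab.symm, h]
      · simp only [true_and, hab, false_and, or_false]
        tauto
    · simp only [blockMiddle, Fin.mk_lt_mk]
      omega
    · rw [hμ]
      split_ifs <;> simp
    · intro z hz hz'
      simp only [blockMiddle, Fin.lt_def] at hz hz'
      rw [blockString_of_lt_of_lt hz (by rw [mul_add]; omega)]
      exact ⟨hac.symm, hbc.symm⟩

/-- Close to the middle of a block, all strings `blockString a b c e t j` agree, so a learner that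
makes fewer than `e` steps cannot detect the value of `j`. -/
theorem outputsWithin_blockString {q ℓ : ℕ} {L : Learner A q ℓ} (he : 0 < e) {j' s : ℕ}
    (hs : s < e) {h : Hypothesis A q ℓ (2 * e * t)}
    (hh : L.OutputsWithin (blockString a b c e t j) (alternatingSet he) s h) :
    L.OutputsWithin (blockString a b c e t j') (alternatingSet he) s h := by
  refine hh.congr fun x hx p h₁ h₂ ↦ ?_
  obtain ⟨i, -, rfl⟩ := Finset.mem_image.1 hx
  simp only [blockMiddle] at h₁ h₂
  have : 2 * e * ((i : ℕ) + 1) = 2 * e * i + 2 * e := by ring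
  rw [blockString_of_lt_of_lt (i := i) (by omega) (by omega),
    blockString_of_lt_of_lt (i := i) (by omega) (by omega)]

/-- Some pair of consecutive blocks contains none of `ℓ` given positions, as each position spoils
at most two of the `2 * ℓ + 2` pairs. -/
theorem exists_free_double_block {ℓ n : ℕ} (v : Fin ℓ → Fin n) (d : ℕ) :
    ∃ k, k + 1 < 2 * ℓ + 3 ∧ ∀ i, (v i : ℕ) / d ≠ k ∧ (v i : ℕ) / d ≠ k + 1 := by
  have hcard : (Finset.univ.image (fun i ↦ (v i : ℕ) / d) ∪
      Finset.univ.image (fun i ↦ (v i : ℕ) / d - 1)).card <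
        (Finset.range (2 * ℓ + 2)).card := by
    refine (Finset.card_union_le _ _).trans_lt ?_
    have h₁ := Finset.card_image_le (s := Finset.univ) (f := fun i ↦ (v i : ℕ) / d)
    have h₂ := Finset.card_image_le (s := Finset.univ) (f := fun i ↦ (v i : ℕ) / d - 1)
    simp only [Finset.card_univ, Fintype.card_fin, Finset.card_range] at h₁ h₂ ⊢
    omega
  obtain ⟨k, hk, hk'⟩ := Finset.exists_mem_notMem_of_card_lt_card hcard
  simp only [Finset.mem_union, Finset.mem_image, Finset.mem_univ, true_and, not_or,
    not_exists] at hk'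
  refine ⟨k, by have := Finset.mem_range.1 hk; omega, fun i ↦ ⟨hk'.1 i, fun h ↦ hk'.2 i ?_⟩⟩
  rw [h, Nat.add_sub_cancel]

/-- If no parameter lies in the blocks `k` and `k + 1`, the middles of these blocks are
indistinguishable in `blockString a b c e t (k + 1)`. -/
theorem blockMiddle_mem_concept_iff {q ℓ N K r k : ℕ}
    (hper : ∀ s r, N ≤ s →
      wordType q (ℓ + 1) 0 (List.replicate (s + K * r) (c, fun _ ↦ False, Fin.elim0)) =
        wordType q (ℓ + 1) 0 (List.replicate s (c, fun _ ↦ False, Fin.elim0)))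
    (he : 0 < e) (heK : e = K * r) (heN : N < e) (hk : k + 1 < t)
    (h : Hypothesis A q ℓ (2 * e * t))
    (hv : ∀ i, (h.params i : ℕ) / (2 * e) ≠ k ∧ (h.params i : ℕ) / (2 * e) ≠ k + 1) :
    blockMiddle he ⟨k, by omega⟩ ∈ h.concept (blockString a b c e t (k + 1)) ↔
      blockMiddle he ⟨k + 1, hk⟩ ∈ h.concept (blockString a b c e t (k + 1)) := by
  have hk₁ : 2 * e * (k + 1) = 2 * e * k + 2 * e := by ring
  have hk₂ : 2 * e * (k + 2) = 2 * e * k + 2 * e + 2 * e := by ring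
  have hkt : 2 * e * (k + 2) ≤ 2 * e * t := Nat.mul_le_mul_left _ hk
  refine holds_cons_iff_of_block (s := e - 1) (r := 2 * r) hper h.rank_le (by omega) ?_ ?_ ?_ ?_ ?_
  · rw [mul_left_comm, ← heK]
    simp only [blockMiddle]
    omega
  · simp only [blockMiddle]
    omega
  · simp only [blockMiddle]
    omega
  · intro i h₁ h₂
    simp only [blockMiddle] at h₁ h₂
    exact blockString_double_block he (by omega) (by omega)
  · intro i
    obtain ⟨h₁, h₂⟩ := hv i
    simp only [blockMiddle]
    rcases lt_or_ge ((h.params i : ℕ) / (2 * e)) k with h' | h'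
    · have := (Nat.div_lt_iff_lt_mul (by omega)).1 h'
      rw [mul_comm k] at this
      omega
    · have := (Nat.le_div_iff_mul_le (by omega)).1
        (show k + 2 ≤ (h.params i : ℕ) / (2 * e) by omega)
      rw [mul_comm (k + 2)] at this
      omega

/-- For a sublinear time bound, there are arbitrarily large half block lengths `e`, divisible by
any given number, that exceed the bound on strings of `t` blocks. -/
theorem exists_block_length {g : ℕ → ℕ}
    (hg : (fun n : ℕ ↦ (g n : ℝ)) =o[atTop] fun n : ℕ ↦ (n : ℝ)) {t K : ℕ} (ht : 0 < t) (hK : 0 < K) (N : ℕ) :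
    ∃ r, N < K * r ∧ g (2 * (K * r) * t) < K * r := by
  have ht' : (0 : ℝ) < t := by exact_mod_cast ht
  obtain ⟨n₀, hn₀⟩ := eventually_atTop.1 (hg.def (show (0 : ℝ) < 1 / (4 * t) by positivity))
  have hr : N + n₀ + 1 ≤ K * (N + n₀ + 1) := Nat.le_mul_of_pos_left _ hK
  refine ⟨N + n₀ + 1, by omega, ?_⟩
  generalize K * (N + n₀ + 1) = e at hr
  have hle := hn₀ (2 * e * t) (by nlinarith)
  simp only [Real.norm_natCast] at hle
  have heq : 1 / (4 * (t : ℝ)) * ((2 * e * t : ℕ) : ℝ) = e / 2 := by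
    push_cast
    field_simp
    ring
  have he : (0 : ℝ) < e := by exact_mod_cast (show 0 < e by omega)
  exact_mod_cast (show (g (2 * e * t) : ℝ) < e by linarith)

/-- Every sublinear learner for the target formula fails on one of the strings
`blockString a b c e (2 * ℓ + 3) j`. -/
theorem exists_failure_of_sublinearFor [Finite A] (hab : a ≠ b) (hac : a ≠ c) (hbc : b ≠ c)
    {q ℓ : ℕ} (L : Learner A q ℓ) (hL : L.SublinearFor (target a b)) :
    ∃ (n : ℕ) (B : Str A n) (T : TrainingSet n),
      (target a b).ConsistentSet B T ∧ T.card = 2 * ℓ + 3 ∧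
      ∃ h, L.Outputs B T h ∧ ¬ ConsistentWith (h.concept B) T := by
  obtain ⟨f, hf, hhalt⟩ := hL
  obtain ⟨N, K, hK, hper⟩ := exists_period_wordType_replicate (k := ℓ + 1) (m := 0) q
    (c, fun _ ↦ False, Fin.elim0)
  obtain ⟨r, heN, hfe⟩ := exists_block_length (t := 2 * ℓ + 3) (hf _) (by omega) hK N
  obtain ⟨e, heK⟩ : ∃ e, e = K * r := ⟨_, rfl⟩
  rw [← heK] at heN hfe
  have he : 0 < e := by omega
  -- The output is the same on all strings of the family; it is computed on one of them.
  obtain ⟨h, hh⟩ := hhalt _ _ _ (consistentSet_target_blockString (t := 2 * ℓ + 3) (j := 1)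
    hab hac hbc he (by omega) (by omega))
  rw [card_alternatingSet] at hh
  obtain ⟨k, hk, hfree⟩ := exists_free_double_block h.params (2 * e)
  refine ⟨_, blockString a b c e (2 * ℓ + 3) (k + 1), alternatingSet he,
    consistentSet_target_blockString hab hac hbc he (by omega) hk, card_alternatingSet he, h,
    ⟨_, outputsWithin_blockString he hfe hh⟩, fun hcons ↦ ?_⟩
  have h₁ := hcons _ (Finset.mem_image_of_mem _ (Finset.mem_univ ⟨k, by omega⟩))
  have h₂ := hcons _ (Finset.mem_image_of_mem _ (Finset.mem_univ ⟨k + 1, hk⟩))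
  have h₃ := blockMiddle_mem_concept_iff (a := a) (b := b) hper he heK heN hk h hfree
  simp only [decide_eq_true_eq, Nat.even_add_one] at h₁ h₂
  tauto

end Adversary

/-- Over every finite alphabet with at least three letters there is a first-order formula
`φ(x ; y) = ∃ z ∀ z' ψ(z, z', x, y)` with quantifier-free `ψ` such that every sublinear
`(q, ℓ)`-formula learner fails on some string and some `φ`-consistent training set of size
`2ℓ + 3`.  Hence no sublinear formula learner for `φ` is consistent. -/
theorem mainTheorem3 (A : Type) [Fintype A] (hA : 3 ≤ Fintype.card A) :
    ∃ (φ : MSO A (1 + 1) 0) (ψ : MSO A 4 0), ψ.QuantifierFree ∧ φ = .ex (.all ψ) ∧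
      (∀ (q ℓ : ℕ) (L : Learner A q ℓ), L.SublinearFor φ →
        ∃ (n : ℕ) (B : Str A n) (T : TrainingSet n),
          φ.ConsistentSet B T ∧ T.card = 2 * ℓ + 3 ∧
          ∃ h, L.Outputs B T h ∧ ¬ ConsistentWith (h.concept B) T) ∧
      (¬ ∃ (q ℓ : ℕ) (L : Learner A q ℓ), L.SublinearFor φ ∧ L.ConsistentFor φ) := by
  obtain ⟨a, b, c, hab, hac, hbc⟩ := Fintype.two_lt_card_iff.1 hA
  refine ⟨target a b, targetMatrix a b, by simp [MSO.QuantifierFree, targetMatrix, MSO.rank], rfl,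
    fun q ℓ L hL ↦ exists_failure_of_sublinearFor hab hac hbc L hL, ?_⟩
  rintro ⟨q, ℓ, L, hL, hcons⟩
  obtain ⟨n, B, T, hT, -, h, hh, hbad⟩ := exists_failure_of_sublinearFor hab hac hbc L hL
  obtain ⟨h', hh', hgood⟩ := hcons n B T hT
  exact hbad (hh'.unique hh ▸ hgood)
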